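/- Let $G$ be a Hausdorff para-topological group: a group with a Hausdorff topology for which multiplication $G\times G\to G$ is jointly continuous (inversion need not be continuous). Let $X$ be a Hausdorff uniform space, not necessarily locally compact, and let $G$ act on $X$ (on the left) so that $G\times X\to X$, $(t,x)\mapsto tx$, is jointly continuous and the orbit closure $\overline{Gx}$ is compact for every $x\in X$. Assume that (i) $G$ is compactly generated: there is a compact set $\Gamma\subseteq G$ with $e\in\Gamma=\Gamma^{-1}$ and $G=\bigcup_{r\ge 1}\Gamma^r$; (ii) $(G,X)$ is distal: for all $x\neq y$ in $X$, the closure of $\{(tx,ty): t\in G\}$ in $X\times X$ does not meet the diagonal; (iii) $\dim\overline{Gx}=0$ for every $x\in X$, i.e. the space $\overline{Gx}$ has a base consisting of clopen sets. Call a subgroup $A$ of $G$ discretely syndetic if $G=K^{-1}A$ for some finite set $K\subseteq G$ (that is, $A$ is syndetic when $G$ is given the discrete topology). Then: (a) under the discrete topology of $G$, $(G,X)$ is pointwise regularly almost periodic: for every $x\in X$ and every neighborhood $U$ of $x$ there is a discretely syndetic normal subgroup $A$ of $G$ with $Ax\subseteq U$; (b) under the discrete topology of $G$, for every $x\in X$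 the subflow $(G,\overline{Gx})$ is (uniformly) regularly almost periodic: for every entourage $\alpha$ of $\overline{Gx}$ (with the uniformity induced from $X$) there is a discretely syndetic normal subgroup $A$ of $G$ with $Ay\subseteq\alpha[y]$ for all $y\in\overline{Gx}$. -/

import Mathlib

open scoped Pointwise Topology

/-- A group `G` with a topology is compactly generated if there is a compact symmetric set `Γ`
containing the identity with `G = ⋃_{r ≥ 1} Γ ^ r`. -/
def IsCompactlyGeneratedGroup (G : Type*) [Group G] [TopologicalSpace G] : Prop :=
  ∃ Γ : Set G, IsCompact Γ ∧ (1 : G) ∈ Γ ∧ Γ⁻¹ = Γ ∧ (⋃ (r : ℕ) (_ : 1 ≤ r), Γ ^ r) = Set.univ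

/-- `Y` has a base consisting of clopen sets. -/
def HasClopenBase (Y : Type*) [TopologicalSpace Y] : Prop :=
  TopologicalSpace.IsTopologicalBasis {s : Set Y | IsClopen s}

/-- The action of `G` on `X` is distal: for `x ≠ y` the orbit closure of `(x, y)` in `X × X` does
not meet the diagonal. -/
def IsDistalAction (G X : Type*) [Group G] [TopologicalSpace X] [MulAction G X] : Prop :=
  ∀ x y : X, x ≠ y → Set.diagonal X ∩ closure (MulAction.orbit G (x, y)) = ∅

/-- `A` is syndetic in `G` with respect to the topology `τ` on `G`: `G = K⁻¹ A` for some
`τ`-compact set `K`. -/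
def IsSyndetic {G : Type*} [Group G] (τ : TopologicalSpace G) (A : Set G) : Prop :=
  ∃ K : Set G, @IsCompact G τ K ∧ K⁻¹ * A = Set.univ

/-- `x` is a regularly almost periodic point, `G` carrying the topology `τ`: for every neighborhood
`U` of `x`, the set `{t | t • x ∈ U}` contains a `τ`-syndetic normal subgroup of `G`. -/
def IsRegularlyAlmostPeriodicPt {G X : Type*} [Group G] (τ : TopologicalSpace G)
    [TopologicalSpace X] [MulAction G X] (x : X) : Prop :=
  ∀ U ∈ 𝓝 x, ∃ A : Subgroup G, A.Normal ∧ IsSyndetic τ (A : Set G) ∧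
    (A : Set G) ⊆ {t : G | t • x ∈ U}

/-- Every point of `X` is regularly almost periodic, `G` carrying the topology `τ`. -/
def IsPointwiseRegularlyAlmostPeriodic {G : Type*} [Group G] (τ : TopologicalSpace G) (X : Type*)
    [TopologicalSpace X] [MulAction G X] : Prop :=
  ∀ x : X, IsRegularlyAlmostPeriodicPt τ x

/-- The action of `G`, carrying the topology `τ`, on the uniform space `X` is (uniformly) regularly
almost periodic: for every entourage `α` there is a `τ`-syndetic normal subgroup `A` of `G` with
`A x ⊆ α[x]` for all `x`. -/
def IsRegularlyAlmostPeriodic {G : Type*} [Group G] (τ : TopologicalSpace G) (X : Type*)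
    [UniformSpace X] [MulAction G X] : Prop :=
  ∀ α ∈ uniformity X, ∃ A : Subgroup G, A.Normal ∧ IsSyndetic τ (A : Set G) ∧
    ∀ x : X, ∀ a ∈ A, (x, a • x) ∈ α

/-- The orbit closure of `x`, as a `G`-invariant subset of `X`; it carries the restricted action
and the uniformity (and topology) induced from `X`. -/
def orbitClosure (G : Type*) {X : Type*} [Group G] [TopologicalSpace X] [MulAction G X]
    [ContinuousConstSMul G X] (x : X) : SubMulAction G X where
  carrier := closure (MulAction.orbit G x)
  smul_mem' := by
    intro g y hy
    refine map_mem_closure (continuous_const_smul g) hy ?_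
    rintro _ ⟨t, rfl⟩
    exact ⟨g * t, mul_smul g t x⟩

/-- In a compact flow of a compactly generated group whose orbit closures are minimal, the largest
invariant subset of a clopen set is open. -/
theorem isOpen_invariant_core {G Z : Type*} [Group G] [TopologicalSpace G] [ContinuousMul G]
    [TopologicalSpace Z] [CompactSpace Z] [T2Space Z] [MulAction G Z] [ContinuousSMul G Z]
    (hG : IsCompactlyGeneratedGroup G)
    (hsymm : ∀ v w : Z, v ∈ closure (MulAction.orbit G w) → w ∈ closure (MulAction.orbit G v))
    {P : Set Z} (hP : IsClopen P) : IsOpen {z : Z | ∀ g : G, g • z ∈ P} := by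
  obtain ⟨Γ, hΓ, h1, hinv, hgen⟩ := hG
  have hΓpow (k : ℕ) : IsCompact (Γ ^ k) := by
    induction k with
    | zero => simp
    | succ k ih => rw [pow_succ]; exact ih.mul hΓ
  have hmono : Monotone fun k : ℕ => Γ ^ k := Set.pow_right_monotone h1
  let E : ℕ → Set Z := fun k => {z | ∀ g ∈ Γ ^ k, g • z ∈ P}
  have hE_anti : Antitone E := fun k l hkl z hz g hg => hz g (hmono hkl hg)
  have hE_closed (k : ℕ) : IsClosed (E k) := by
    have : E k = ⋂ g ∈ Γ ^ k, (fun z => g • z) ⁻¹' P := by ext; simp [E]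
    rw [this]
    exact isClosed_biInter fun g _ => hP.isClosed.preimage (continuous_const_smul g)
  have hE_open (k : ℕ) : IsOpen (E k) := by
    rw [isOpen_iff_eventually]
    intro z hz
    exact (hΓpow k).eventually_forall_of_forall_eventually (P := fun z g => g • z ∈ P)
      fun g hg => (show Continuous fun q : Z × G => q.2 • q.1 from
        continuous_snd.smul continuous_fst).continuousAt.eventually_mem
        (hP.isOpen.mem_nhds (hz g hg))
  have hcore : {z : Z | ∀ g : G, g • z ∈ P} = ⋂ k, E k := by
    ext z
    simp only [Set.mem_ofPred_eq, Set.mem_iInter, E]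
    refine ⟨fun h k g _ => h g, fun h g => ?_⟩
    have hg : g ∈ ⋃ (r : ℕ) (_ : 1 ≤ r), Γ ^ r := hgen ▸ Set.mem_univ g
    simp only [Set.mem_iUnion] at hg
    obtain ⟨r, -, hg⟩ := hg
    exact h r g hg
  by_cases hstab : ∃ k, E k ⊆ ⋂ k, E k
  · obtain ⟨k, hk⟩ := hstab
    rw [hcore, (Set.iInter_subset E k).antisymm hk]
    exact hE_open k
  exfalso
  push Not at hstab
  let W : ℕ → Set Z := fun k => {w | w ∉ P ∧ ∃ s ∈ Γ ^ (k + 1), s • w ∈ E k}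
  have hW_compact (k : ℕ) : IsCompact (W k) := by
    have hc : IsCompact ((Γ ^ (k + 1)) ×ˢ Pᶜ ∩ (fun q : G × Z => q.1 • q.2) ⁻¹' E k) :=
      ((hΓpow (k + 1)).prod hP.compl.isClosed.isCompact).inter_right
        ((hE_closed k).preimage continuous_smul)
    convert hc.image continuous_snd using 1
    ext w
    simp only [W, Set.mem_ofPred_eq, Set.mem_image, Set.mem_inter_iff, Set.mem_prod,
      Set.mem_preimage, Prod.exists, Set.mem_compl_iff]
    constructor
    · rintro ⟨hw, s, hs, hsw⟩
      exact ⟨s, w, ⟨⟨hs, hw⟩, hsw⟩, rfl⟩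
    · rintro ⟨s, _, ⟨⟨hs, hw⟩, hsw⟩, rfl⟩
      exact ⟨hw, s, hs, hsw⟩
  have hW_anti (k : ℕ) : W (k + 1) ⊆ W k := by
    rintro w ⟨hw, s, hs, hsw⟩
    rw [pow_succ' Γ (k + 1)] at hs
    obtain ⟨a, ha, b, hb, rfl⟩ := Set.mem_mul.1 hs
    refine ⟨hw, b, hb, fun g hg => ?_⟩
    have ha' : a⁻¹ ∈ Γ := by rw [← hinv]; exact Set.inv_mem_inv.2 ha
    have := hsw (g * a⁻¹) (by rw [pow_succ]; exact Set.mul_mem_mul hg ha')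
    simpa [smul_smul, mul_assoc] using this
  have hW_nonempty (k : ℕ) : (W k).Nonempty := by
    classical
    obtain ⟨v, hvk, hv⟩ := Set.not_subset.1 (hstab k)
    have hex : ∃ n, v ∉ E n := by simpa using hv
    obtain ⟨m, hm⟩ : ∃ m, Nat.find hex = m + 1 + k := by
      have hlt : k < Nat.find hex := by
        by_contra! hle
        exact Nat.find_spec hex (hE_anti hle hvk)
      exact ⟨Nat.find hex - k - 1, by omega⟩
    have hvm : v ∈ E (k + m) := not_not.1 (Nat.find_min hex (by omega))
    have hvm' : ∃ g ∈ Γ ^ ((k + 1) + m), g • v ∉ P := by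
      have := Nat.find_spec hex
      rw [hm, show m + 1 + k = (k + 1) + m by ring] at this
      simpa [E] using this
    obtain ⟨g, hg, hgv⟩ := hvm'
    rw [pow_add] at hg
    obtain ⟨a, ha, d, hd, rfl⟩ := Set.mem_mul.1 hg
    refine ⟨(a * d) • v, hgv, a⁻¹, ?_, fun c hc => ?_⟩
    · rw [← hinv, inv_pow]
      exact Set.inv_mem_inv.2 ha
    · have := hvm (c * d) (by rw [pow_add]; exact Set.mul_mem_mul hc hd)
      simpa [smul_smul, mul_assoc] using this
  obtain ⟨w, hw⟩ := IsCompact.nonempty_iInter_of_sequence_nonempty_isCompact_isClosed W hW_anti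
    hW_nonempty (hW_compact 0) fun k => (hW_compact k).isClosed
  rw [Set.mem_iInter] at hw
  obtain ⟨v, hv⟩ := IsCompact.nonempty_iInter_of_sequence_nonempty_isCompact_isClosed
    (fun k => closure (MulAction.orbit G w) ∩ E k)
    (fun k => Set.inter_subset_inter_right _ (hE_anti k.le_succ))
    (fun k => by
      obtain ⟨-, s, -, hs⟩ := hw k
      exact ⟨s • w, subset_closure ⟨s, rfl⟩, hs⟩)
    (isClosed_closure.inter (hE_closed 0)).isCompact
    fun k => isClosed_closure.inter (hE_closed k)
  rw [Set.mem_iInter] at hv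
  have hvcore : v ∈ {z : Z | ∀ g : G, g • z ∈ P} := by
    rw [hcore]; exact Set.mem_iInter.2 fun k => (hv k).2
  have hsub : closure (MulAction.orbit G v) ⊆ P := by
    refine closure_minimal ?_ hP.isClosed
    rintro _ ⟨g, rfl⟩
    exact hvcore g
  exact (hw 0).1 (hsub (hsymm v w (hv 0).1))

/-- The self-maps of `Y`, with composition as multiplication and the topology of pointwise
convergence. -/
def PointwiseEnd (Y : Type*) : Type _ := Y → Y

instance (Y : Type*) : Semigroup (PointwiseEnd Y) where
  mul f g := fun y => f (g y)
  mul_assoc _ _ _ := rfl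

instance (Y : Type*) [TopologicalSpace Y] : TopologicalSpace (PointwiseEnd Y) :=
  inferInstanceAs (TopologicalSpace (Y → Y))

instance (Y : Type*) [TopologicalSpace Y] [T2Space Y] : T2Space (PointwiseEnd Y) :=
  inferInstanceAs (T2Space (Y → Y))

instance (Y : Type*) [TopologicalSpace Y] [CompactSpace Y] : CompactSpace (PointwiseEnd Y) :=
  inferInstanceAs (CompactSpace (Y → Y))

theorem PointwiseEnd.continuous_eval {Y : Type*} [TopologicalSpace Y] (y : Y) :
    Continuous fun f : PointwiseEnd Y => f y :=
  continuous_apply (A := fun _ : Y => Y) y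

theorem PointwiseEnd.continuous_mul_const {Y : Type*} [TopologicalSpace Y] (f : PointwiseEnd Y) :
    Continuous fun g : PointwiseEnd Y => g * f :=
  continuous_pi fun y => PointwiseEnd.continuous_eval (f y)

/-- The translation by `g`. -/
def PointwiseEnd.translation {G : Type*} (Y : Type*) [Group G] [MulAction G Y] (g : G) :
    PointwiseEnd Y :=
  fun y => g • y

/-- The enveloping semigroup of an action: the pointwise closure of the set of translations. -/
def ellisSemigroup (G Y : Type*) [Group G] [TopologicalSpace Y] [MulAction G Y] :
    Set (PointwiseEnd Y) :=
  closure (Set.range (PointwiseEnd.translation (G := G) Y))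

theorem mul_mem_ellisSemigroup {G Y : Type*} [Group G] [TopologicalSpace Y] [MulAction G Y]
    [ContinuousConstSMul G Y] {p q : PointwiseEnd Y} (hp : p ∈ ellisSemigroup G Y)
    (hq : q ∈ ellisSemigroup G Y) : p * q ∈ ellisSemigroup G Y := by
  have hsmul (g : G) : PointwiseEnd.translation Y g * q ∈ ellisSemigroup G Y := by
    have hcont : Continuous fun f : PointwiseEnd Y =>
        PointwiseEnd.translation Y g * f :=
      continuous_pi fun y => (continuous_const_smul g).comp (PointwiseEnd.continuous_eval y)
    refine map_mem_closure hcont hq ?_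
    rintro _ ⟨h, rfl⟩
    exact ⟨g * h, funext fun y => mul_smul g h y⟩
  have := map_mem_closure (t := ellisSemigroup G Y) (PointwiseEnd.continuous_mul_const q) hp
    (by rintro _ ⟨g, rfl⟩; exact hsmul g)
  rwa [ellisSemigroup, closure_closure] at this

theorem mem_closure_orbit_prod_of_mem_ellisSemigroup {G Y : Type*} [Group G] [TopologicalSpace Y]
    [MulAction G Y] {p : PointwiseEnd Y} (hp : p ∈ ellisSemigroup G Y) (x y : Y) :
    (p x, p y) ∈ closure (MulAction.orbit G (x, y)) := by
  refine map_mem_closure (f := fun f : PointwiseEnd Y => (f x, f y))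
    ((PointwiseEnd.continuous_eval x).prodMk (PointwiseEnd.continuous_eval y)) hp ?_
  rintro _ ⟨g, rfl⟩
  exact ⟨g, rfl⟩

theorem exists_ellisSemigroup_of_mem_closure_orbit {G Y : Type*} [Group G] [TopologicalSpace Y]
    [CompactSpace Y] [T2Space Y] [MulAction G Y] {v w : Y × Y}
    (h : v ∈ closure (MulAction.orbit G w)) :
    ∃ p ∈ ellisSemigroup G Y, (p w.1, p w.2) = v := by
  have hc : IsCompact ((fun f : PointwiseEnd Y => (f w.1, f w.2)) '' ellisSemigroup G Y) :=
    (isClosed_closure.isCompact).image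
      ((PointwiseEnd.continuous_eval w.1).prodMk (PointwiseEnd.continuous_eval w.2))
  refine closure_minimal ?_ hc.isClosed h
  rintro _ ⟨g, rfl⟩
  exact ⟨_, subset_closure ⟨g, rfl⟩, rfl⟩

/-- Orbit closures in the square of a compact distal flow are minimal. -/
theorem IsDistalAction.mem_closure_orbit_symm {G Y : Type*} [Group G] [TopologicalSpace Y]
    [CompactSpace Y] [T2Space Y] [MulAction G Y] [ContinuousConstSMul G Y]
    (hd : IsDistalAction G Y) (v w : Y × Y) (h : v ∈ closure (MulAction.orbit G w)) :
    w ∈ closure (MulAction.orbit G v) := by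
  obtain ⟨p, hp, rfl⟩ := exists_ellisSemigroup_of_mem_closure_orbit h
  obtain ⟨u, ⟨q, hq, hqu⟩, hu⟩ := exists_idempotent_in_compact_subsemigroup
    (PointwiseEnd.continuous_mul_const (Y := Y)) ((fun q => q * p) '' ellisSemigroup G Y)
    (Set.Nonempty.image _ ⟨p, hp⟩)
    ((isClosed_closure.isCompact).image (PointwiseEnd.continuous_mul_const p))
    (by
      rintro _ ⟨a, ha, rfl⟩ _ ⟨b, hb, rfl⟩
      exact ⟨a * p * b, mul_mem_ellisSemigroup (mul_mem_ellisSemigroup ha hp) hb, rfl⟩)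
  have hid (y : Y) : u y = y := by
    by_contra hne
    have hmem := mem_closure_orbit_prod_of_mem_ellisSemigroup
      (hqu ▸ mul_mem_ellisSemigroup hq hp : u ∈ ellisSemigroup G Y) (u y) y
    have hdiag : (u (u y), u y) ∈ Set.diagonal Y := congrFun hu y
    exact (Set.ext_iff.1 (hd (u y) y hne) _).1 ⟨hdiag, hmem⟩
  have := mem_closure_orbit_prod_of_mem_ellisSemigroup hq (p w.1) (p w.2)
  have hqp (y : Y) : q (p y) = y := (congrFun hqu y).trans (hid y)
  rwa [hqp, hqp] at this

/-- A compact uniform space with a clopen base has arbitrarily fine clopen equivalence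
relations. -/
theorem exists_isClopen_setoid_le {Y : Type*} [UniformSpace Y] [CompactSpace Y]
    (hdim : HasClopenBase Y) {α : Set (Y × Y)} (hα : α ∈ uniformity Y) :
    ∃ S : Setoid Y, IsClopen {p : Y × Y | S p.1 p.2} ∧ {p : Y × Y | S p.1 p.2} ⊆ α := by
  have hloc (y : Y) : ∃ C : Set Y, IsClopen C ∧ y ∈ C ∧ C ×ˢ C ⊆ α := by
    obtain ⟨V, hV, hVα⟩ := mem_nhds_prod_iff.1
      (nhds_le_uniformity y hα : α ∈ 𝓝 (y, y))
    obtain ⟨V', hV', hVα⟩ := hVα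
    obtain ⟨C, hC, hyC, hCV⟩ := hdim.mem_nhds_iff.1 (Filter.inter_mem hV hV')
    exact ⟨C, hC, hyC, (Set.prod_mono (hCV.trans Set.inter_subset_left)
      (hCV.trans Set.inter_subset_right)).trans hVα⟩
  choose C hC hyC hCα using hloc
  obtain ⟨t, ht⟩ := CompactSpace.elim_nhds_subcover C fun y => (hC y).isOpen.mem_nhds (hyC y)
  refine ⟨⟨fun y z => ∀ i ∈ t, (y ∈ C i ↔ z ∈ C i), fun _ _ _ => Iff.rfl,
    fun h i hi => (h i hi).symm, fun h h' i hi => (h i hi).trans (h' i hi)⟩, ?_, ?_⟩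
  · have : {p : Y × Y | ∀ i ∈ t, (p.1 ∈ C i ↔ p.2 ∈ C i)} =
        ⋂ i ∈ t, ((C i ×ˢ C i) ∪ ((C i)ᶜ ×ˢ (C i)ᶜ)) := by
      ext p
      simp only [Set.mem_ofPred_eq, Set.mem_iInter, Set.mem_union, Set.mem_prod, Set.mem_compl_iff]
      exact forall₂_congr fun i _ => by tauto
    change IsClopen {p : Y × Y | ∀ i ∈ t, (p.1 ∈ C i ↔ p.2 ∈ C i)}
    rw [this]
    exact t.finite_toSet.isClopen_biInter fun i _ =>
      ((hC i).prod (hC i)).union ((hC i).compl.prod (hC i).compl)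
  · rintro ⟨y, z⟩ h
    have hy : y ∈ ⋃ i ∈ t, C i := ht ▸ Set.mem_univ y
    simp only [Set.mem_iUnion] at hy
    obtain ⟨i, hi, hyi⟩ := hy
    exact hCα i ⟨hyi, (h i hi).1 hyi⟩

theorem Setoid.finite_quotient_of_isOpen {Y : Type*} [TopologicalSpace Y] [CompactSpace Y]
    (S : Setoid Y) (hS : IsOpen {p : Y × Y | S p.1 p.2}) : Finite (Quotient S) := by
  obtain ⟨t, ht⟩ := CompactSpace.elim_nhds_subcover (fun y : Y => {z | S y z}) fun y =>
    (hS.preimage (Continuous.prodMk_right y)).mem_nhds (S.refl y)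
  refine Set.finite_univ_iff.1 ((t.finite_toSet.image (Quotient.mk S)).subset ?_)
  rintro ⟨z⟩ -
  have hz : z ∈ ⋃ y ∈ t, {z | S y z} := ht ▸ Set.mem_univ z
  simp only [Set.mem_iUnion] at hz
  obtain ⟨y, hy, hyz⟩ := hz
  exact ⟨y, hy, Quotient.sound hyz⟩

theorem Subgroup.isSyndetic_bot_of_finiteIndex {G : Type*} [Group G] (A : Subgroup G)
    [A.FiniteIndex] : IsSyndetic (⊥ : TopologicalSpace G) (A : Set G) := by
  refine ⟨Set.range fun q : G ⧸ A => q.out⁻¹, ?_, ?_⟩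
  · exact @Set.Finite.isCompact G ⊥ _ (Set.finite_range _)
  · refine Set.eq_univ_of_forall fun g => ?_
    refine ⟨(g : G ⧸ A).out, ⟨(g : G ⧸ A), rfl⟩, (g : G ⧸ A).out⁻¹ * g, ?_, by simp⟩
    exact QuotientGroup.eq.1 (Quotient.out_eq' _)

/-- The elements moving every point inside its class, for an invariant equivalence relation with
finitely many classes, form a syndetic normal subgroup. -/
theorem exists_normal_syndetic_of_setoid {G Y : Type*} [Group G] [MulAction G Y] (S : Setoid Y)
    (hS : ∀ (g : G) (y z : Y), S y z → S (g • y) (g • z)) [Finite (Quotient S)] :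
    ∃ A : Subgroup G, A.Normal ∧ IsSyndetic (⊥ : TopologicalSpace G) (A : Set G) ∧
      ∀ y : Y, ∀ a ∈ A, S y (a • y) := by
  let act : MulAction G (Quotient S) :=
    { smul := fun g => Quotient.map (fun y => g • y) fun y z h => hS g y z h
      one_smul := by rintro ⟨y⟩; exact congrArg (Quotient.mk S) (one_smul G y)
      mul_smul := by rintro g h ⟨y⟩; exact congrArg (Quotient.mk S) (mul_smul g h y) }
  refine ⟨(MulAction.toPermHom G (Quotient S)).ker, inferInstance,
    Subgroup.isSyndetic_bot_of_finiteIndex _, fun y a ha => ?_⟩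
  have h : a • (Quotient.mk S y) = Quotient.mk S y :=
    congrArg (fun σ : Equiv.Perm (Quotient S) => σ (Quotient.mk S y)) ha
  exact Quotient.exact h.symm

/-- A compact zero-dimensional distal flow of a compactly generated group is regularly almost
periodic for the discrete topology of the group. -/
theorem IsDistalAction.isRegularlyAlmostPeriodic {G Y : Type*} [Group G] [TopologicalSpace G]
    [ContinuousMul G] [UniformSpace Y] [CompactSpace Y] [T2Space Y] [MulAction G Y]
    [ContinuousSMul G Y] (hG : IsCompactlyGeneratedGroup G) (hd : IsDistalAction G Y)
    (hdim : HasClopenBase Y) : IsRegularlyAlmostPeriodic (⊥ : TopologicalSpace G) Y := by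
  intro α hα
  obtain ⟨S, hS, hSα⟩ := exists_isClopen_setoid_le hdim hα
  let T : Setoid Y := ⟨fun y z => ∀ g : G, S (g • y) (g • z), fun _ _ => S.refl _,
    fun h g => S.symm (h g), fun h h' g => S.trans (h g) (h' g)⟩
  have hT : IsOpen {p : Y × Y | T p.1 p.2} :=
    isOpen_invariant_core hG hd.mem_closure_orbit_symm hS
  have := T.finite_quotient_of_isOpen hT
  obtain ⟨A, hA, hsynd, hAT⟩ := exists_normal_syndetic_of_setoid (G := G) T
    fun g y z h k => by simpa [smul_smul] using h (k * g)
  refine ⟨A, hA, hsynd, fun y a ha => hSα ?_⟩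
  simpa using hAT y a ha 1

theorem IsDistalAction.subMulAction {G X : Type*} [Group G] [TopologicalSpace X] [MulAction G X]
    (hd : IsDistalAction G X) (Y : SubMulAction G X) : IsDistalAction G Y := by
  intro x y hxy
  rw [Set.eq_empty_iff_forall_notMem]
  rintro ⟨a, b⟩ ⟨hab, hmem⟩
  have hcont : Continuous fun p : Y × Y => ((p.1 : X), (p.2 : X)) :=
    (continuous_subtype_val.comp continuous_fst).prodMk (continuous_subtype_val.comp continuous_snd)
  refine (Set.ext_iff.1 (hd x y (Subtype.coe_injective.ne hxy)) (a, b)).1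
    ⟨congrArg Subtype.val hab, map_mem_closure (f := fun p : Y × Y => ((p.1 : X), (p.2 : X)))
      hcont hmem ?_⟩
  rintro _ ⟨g, rfl⟩
  exact ⟨g, rfl⟩

/-- `⊥` is the discrete topology on `G`. -/
theorem theorem3p1p3 {G X : Type*} [Group G] [TopologicalSpace G] [T2Space G] [ContinuousMul G]
    [UniformSpace X] [T2Space X] [MulAction G X] [ContinuousSMul G X]
    (hLagrange : ∀ x : X, IsCompact (closure (MulAction.orbit G x)))
    (hG : IsCompactlyGeneratedGroup G)
    (hdistal : IsDistalAction G X)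
    (hdim : ∀ x : X, HasClopenBase (orbitClosure G x)) :
    IsPointwiseRegularlyAlmostPeriodic (⊥ : TopologicalSpace G) X ∧
      ∀ x : X, IsRegularlyAlmostPeriodic (⊥ : TopologicalSpace G) (orbitClosure G x) := by
  have hb (x : X) : IsRegularlyAlmostPeriodic (⊥ : TopologicalSpace G) (orbitClosure G x) := by
    have : CompactSpace (orbitClosure G x) := isCompact_iff_compactSpace.1 (hLagrange x)
    have : ContinuousSMul G (orbitClosure G x) :=
      ⟨(continuous_fst.smul (continuous_subtype_val.comp continuous_snd)).subtype_mk _⟩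
    exact (hdistal.subMulAction _).isRegularlyAlmostPeriodic hG (hdim x)
  refine ⟨fun x U hU => ?_, hb⟩
  obtain ⟨α, hα, hαU⟩ := UniformSpace.mem_nhds_iff.1 hU
  obtain ⟨A, hA, hsynd, hAα⟩ := hb x
    ((fun p : orbitClosure G x × orbitClosure G x => ((p.1 : X), (p.2 : X))) ⁻¹' α)
    (Filter.preimage_mem_comap hα)
  refine ⟨A, hA, hsynd, fun a ha => hαU ?_⟩
  exact hAα ⟨x, subset_closure (MulAction.mem_orbit_self x)⟩ a ha
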